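/- All Hilbert spaces are complex, of arbitrary dimension. A linear relation $T$ from $\mathfrak H$ to $\mathfrak K$ is a linear subspace of $\mathfrak H\times\mathfrak K$; it is closed if it is closed in the product topology. Put $\operatorname{dom}T=\{f:\{f,f'\}\in T \text{ for some } f'\}$ and $\operatorname{mul}T=\{f':\{0,f'\}\in T\}$. The product of relations is $ST=\{\{f,g\}:\{f,h\}\in T,\ \{h,g\}\in S\text{ for some }h\}$, an operator is identified with its graph, $aT=\{\{f,af'\}:\{f,f'\}\in T\}$ for a scalar $a$, the adjoint is $T^*=\{\{g,g'\}\in\mathfrak K\times\mathfrak H:(f',g)=(f,g')\text{ for all }\{f,f'\}\in T\}$, and the operator part of a closed relation $T$ is $T_{\rm s}=\{\{f,f'\}\in T: f'\perp\operatorname{mul}T\}$. A relation $R$ in $\mathfrak H$ is nonnegative selfadjoint if $R=R^*$ and $(f',f)\ge 0$ for all $\{f,f'\}\in R$; then $R^{1/2}$ denotes the unique nonnegative selfadjoint relation with $R^{1/2}R^{1/2}=R$. For nonnegative selfadjoint relations $R_1,R_2$ in $\mathfrak H$ one writes $R_1\le R_2$ if $\operatorname{dom}(R_2^{1/2})_{\rm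 s}\subset\operatorname{dom}(R_1^{1/2})_{\rm s}$ and $\|(R_1^{1/2})_{\rm s}h\|\le\|(R_2^{1/2})_{\rm s}h\|$ for all $h\in\operatorname{dom}(R_2^{1/2})_{\rm s}$. Finally $\dim$ is the Hilbert space dimension, i.e. the cardinality of an orthonormal basis. **Proposition.** Let $\mathfrak H_A$, $\mathfrak H_B$ and $\mathfrak H$ be Hilbert spaces, let $A$ be a closed linear relation from $\mathfrak H$ to $\mathfrak H_A$, and let $B$ be a closed linear relation from $\mathfrak H$ to $\mathfrak H_B$. Then there exists a bounded everywhere defined linear operator $Z\in\mathbf B(\mathfrak H_B,\mathfrak H_A)$ such that $A=ZB$ if and only if the following three conditions are satisfied: (i) there is $c\ge 0$ such that $A^*A\le c^2B^*B$ (which includes that $c^2B^*B$ is nonnegative selfadjoint; this is automatic for $c>0$); (ii) $\operatorname{dom}A=\operatorname{dom}B$; (iii) $\dim(\operatorname{mul}A)\le\dim(\operatorname{mul}B)$. -/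

import Mathlib

open scoped InnerProductSpace

universe u v w

namespace LinRel



section Algebra

variable {E : Type u} {F : Type v} {G : Type w}
variable [AddCommGroup E] [Module ℂ E] [AddCommGroup F] [Module ℂ F] [AddCommGroup G] [Module ℂ G]

/-- The domain of a linear relation `R` from `E` to `F`, that is, of a linear subspace of `E × F`. -/
def dom (R : Submodule ℂ (E × F)) : Submodule ℂ E :=
  R.map (LinearMap.fst ℂ E F)

/-- The multivalued part `{y | (0, y) ∈ R}` of a linear relation `R`. -/
def mul (R : Submodule ℂ (E × F)) : Submodule ℂ F :=
  R.comap (LinearMap.inr ℂ E F)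

/-- The product `S R = {(x, z) | (x, y) ∈ R and (y, z) ∈ S for some y}`. -/
def comp (S : Submodule ℂ (F × G)) (R : Submodule ℂ (E × F)) : Submodule ℂ (E × G) where
  carrier := {p | ∃ y, (p.1, y) ∈ R ∧ (y, p.2) ∈ S}
  zero_mem' := ⟨0, R.zero_mem, S.zero_mem⟩
  add_mem' := by
    rintro p q ⟨y, hy, hy'⟩ ⟨z, hz, hz'⟩
    exact ⟨y + z, R.add_mem hy hz, S.add_mem hy' hz'⟩
  smul_mem' := by
    rintro a p ⟨y, hy, hy'⟩
    exact ⟨a • y, R.smul_mem a hy, S.smul_mem a hy'⟩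

/-- The scalar multiple `a R = {(x, a y) | (x, y) ∈ R}`. -/
def scale (a : ℂ) (R : Submodule ℂ (E × F)) : Submodule ℂ (E × F) :=
  R.map (LinearMap.prodMap LinearMap.id (a • LinearMap.id))

end Algebra

section Hilbert

variable {E : Type u} {F : Type v}
variable [NormedAddCommGroup E] [InnerProductSpace ℂ E]
variable [NormedAddCommGroup F] [InnerProductSpace ℂ F]

/-- The operator part `R ⊖ ({0} × mul R)` of a (closed) linear relation `R`: the pairs `(x, y)` in
`R` that are orthogonal to all `(0, m)` with `m ∈ mul R`, i.e. those with `y ⟂ mul R`. -/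
noncomputable def operPart (R : Submodule ℂ (E × F)) : Submodule ℂ (E × F) :=
  R ⊓ (mul R)ᗮ.comap (LinearMap.snd ℂ E F)

/-- A linear relation in `E` is nonnegative if `⟪x', x⟫` is real and `≥ 0` for all
`(x, x') ∈ R`. -/
def IsNonneg (R : Submodule ℂ (E × E)) : Prop :=
  ∀ p ∈ R, 0 ≤ (⟪p.2, p.1⟫_ℂ).re ∧ (⟪p.2, p.1⟫_ℂ).im = 0

/-- A linear relation in `E` is nonnegative selfadjoint if it is nonnegative and equal to its
adjoint relation. -/
def IsNonnegSelfAdjoint (R : Submodule ℂ (E × E)) : Prop :=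
  R.adjoint = R ∧ IsNonneg R

/-- `K` is the square root `R ^ (1 / 2)` of the relation `R`: a nonnegative selfadjoint relation
with `K ^ 2 = R`. (In a Hilbert space a nonnegative selfadjoint `R` has exactly one such `K`.) -/
def IsSqrt (K R : Submodule ℂ (E × E)) : Prop :=
  IsNonnegSelfAdjoint K ∧ comp K K = R

/-- The ordering `R₁ ≤ R₂` of nonnegative selfadjoint relations: with `K₁`, `K₂` the square roots
of `R₁`, `R₂` and `(K₁)ₛ`, `(K₂)ₛ` their operator parts, `dom (K₂)ₛ ⊆ dom (K₁)ₛ` and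
`‖(K₁)ₛ x‖ ≤ ‖(K₂)ₛ x‖` for every `x` in `dom (K₂)ₛ`. -/
def OpLE (R₁ R₂ : Submodule ℂ (E × E)) : Prop :=
  IsNonnegSelfAdjoint R₁ ∧ IsNonnegSelfAdjoint R₂ ∧
    ∃ K₁ K₂ : Submodule ℂ (E × E), IsSqrt K₁ R₁ ∧ IsSqrt K₂ R₂ ∧
      dom (operPart K₂) ≤ dom (operPart K₁) ∧
      ∀ x y₁ y₂ : E, (x, y₁) ∈ operPart K₁ → (x, y₂) ∈ operPart K₂ → ‖y₁‖ ≤ ‖y₂‖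

/-- The Hilbert space dimension: the cardinality of an orthonormal basis, i.e. of an orthonormal
set whose linear span is dense. (Every Hilbert space has orthonormal bases, all of the same
cardinality, so the infimum only selects the common value.) -/
noncomputable def hilbertDim (E : Type u) [NormedAddCommGroup E] [InnerProductSpace ℂ E] :
    Cardinal.{u} :=
  sInf {κ | ∃ s : Set E, Orthonormal ℂ ((↑) : s → E) ∧
    (Submodule.span ℂ s).topologicalClosure = ⊤ ∧ Cardinal.mk s = κ}

end Hilbert

end LinRel

namespace LinRel

/-! ### Elementary calculus of linear relations -/

section Algebra

variable {E : Type u} {F : Type v} {G : Type w}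
variable [AddCommGroup E] [Module ℂ E] [AddCommGroup F] [Module ℂ F] [AddCommGroup G] [Module ℂ G]

/-! A closed relation splits into its operator part and its multivalued part, and the conditions
separate accordingly. If `A = Z B`, the domains agree and `Z` maps `mul B` onto `mul A`; since `Aₛ
x` is the value of least norm and `Z z` is a value of `A` for every value `z` of `B` at `x`, also
`‖Aₛ x‖ ≤ ‖Z‖ ‖Bₛ x‖`. Conversely, with equal domains and `‖Aₛ x‖ ≤ c ‖Bₛ x‖`, the map `Bₛ x ↦ Aₛ x`
is well defined and bounded. Extend it by zero to the complement of `ran Bₛ` and add a bounded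
surjection `mul B → mul A` preceded by the projection onto `mul B`; the sum is `Z`.

Two translations remain. The order between `A* A` and `c² B* B` is defined through square roots;
`opLE_adjoint_comp_self_iff` turns it into the norm inequality, because `R* R` determines `dom R`
and the norms `‖Rₛ x‖`: its domain is a core for `Rₛ` (`exists_seq_core`). The inequality of
dimensions means that a bounded surjection exists (`hilbertDim_le_iff_exists_surjective`). -/

theorem mem_dom {R : Submodule ℂ (E × F)} {x : E} : x ∈ dom R ↔ ∃ y, (x, y) ∈ R := by
  simp [dom]

theorem mem_mul {R : Submodule ℂ (E × F)} {y : F} : y ∈ mul R ↔ (0, y) ∈ R := by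
  simp [mul]

theorem mem_comp {S : Submodule ℂ (F × G)} {R : Submodule ℂ (E × F)} {x : E} {z : G} :
    (x, z) ∈ comp S R ↔ ∃ y, (x, y) ∈ R ∧ (y, z) ∈ S := Iff.rfl

theorem mem_scale {a : ℂ} {R : Submodule ℂ (E × F)} {x : E} {z : F} :
    (x, z) ∈ scale a R ↔ ∃ y, (x, y) ∈ R ∧ a • y = z := by
  simp [scale]

theorem sub_mem_mul {R : Submodule ℂ (E × F)} {x : E} {y z : F} (hy : (x, y) ∈ R)
    (hz : (x, z) ∈ R) : y - z ∈ mul R := by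
  simpa [mem_mul] using R.sub_mem hy hz

end Algebra

section Hilbert

variable {E : Type u} {F : Type v} {G : Type w}
variable [NormedAddCommGroup E] [InnerProductSpace ℂ E]
variable [NormedAddCommGroup F] [InnerProductSpace ℂ F]
variable [NormedAddCommGroup G] [InnerProductSpace ℂ G]

/-! ### Adjoints and operator parts -/

theorem mem_adjoint {R : Submodule ℂ (E × F)} {y : F} {x : E} :
    (y, x) ∈ R.adjoint ↔ ∀ a b, (a, b) ∈ R → ⟪b, y⟫_ℂ = ⟪a, x⟫_ℂ := by
  simp only [Submodule.mem_adjoint_iff, sub_eq_zero]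

theorem mem_operPart {R : Submodule ℂ (E × F)} {x : E} {y : F} :
    (x, y) ∈ operPart R ↔ (x, y) ∈ R ∧ y ∈ (mul R)ᗮ := by
  simp [operPart]

theorem isClosed_adjoint (R : Submodule ℂ (E × F)) :
    IsClosed (R.adjoint : Set (F × E)) := by
  have : (R.adjoint : Set (F × E)) =
      ⋂ p ∈ R, {q | ⟪p.2, q.1⟫_ℂ = ⟪p.1, q.2⟫_ℂ} := by
    ext ⟨y, x⟩
    simp [Submodule.mem_adjoint_iff, sub_eq_zero]
  rw [this]
  exact isClosed_biInter fun p _ => isClosed_eq (by fun_prop) (by fun_prop)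

theorem isClosed_mul {R : Submodule ℂ (E × F)} (hR : IsClosed (R : Set (E × F))) :
    IsClosed (mul R : Set F) :=
  hR.preimage (f := fun y : F => ((0 : E), y)) (by fun_prop)

theorem isClosed_operPart {R : Submodule ℂ (E × F)} (hR : IsClosed (R : Set (E × F))) :
    IsClosed (operPart R : Set (E × F)) := by
  have : (operPart R : Set (E × F)) = (R : Set (E × F)) ∩ Prod.snd ⁻¹' ((mul R)ᗮ : Set F) := by
    ext ⟨x, y⟩
    simp [mem_operPart]
  rw [this]
  exact hR.inter ((Submodule.isClosed_orthogonal _).preimage continuous_snd)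

/-- The domain of the operator part of a closed relation is the whole domain; more precisely every
value differs from the value of the operator part by an element of the multivalued part. -/
theorem exists_operPart [CompleteSpace F] {R : Submodule ℂ (E × F)}
    (hR : IsClosed (R : Set (E × F))) {x : E} {y : F} (h : (x, y) ∈ R) :
    ∃ z, (x, z) ∈ operPart R ∧ y - z ∈ mul R := by
  have : CompleteSpace (mul R) := (isClosed_mul hR).completeSpace_coe
  obtain ⟨m, hm, z, hz, rfl⟩ := Submodule.exists_add_mem_mem_orthogonal (K := mul R) y
  refine ⟨z, mem_operPart.2 ⟨?_, hz⟩, by simpa using hm⟩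
  simpa using R.sub_mem h (mem_mul.1 hm)

theorem dom_operPart [CompleteSpace F] {R : Submodule ℂ (E × F)}
    (hR : IsClosed (R : Set (E × F))) : dom (operPart R) = dom R := by
  ext x
  simp only [mem_dom]
  refine ⟨fun ⟨y, hy⟩ => ⟨y, (mem_operPart.1 hy).1⟩, fun ⟨y, hy⟩ => ?_⟩
  obtain ⟨z, hz, -⟩ := exists_operPart hR hy
  exact ⟨z, hz⟩

theorem eq_of_mem_operPart {R : Submodule ℂ (E × F)} {x : E} {y z : F}
    (hy : (x, y) ∈ operPart R) (hz : (x, z) ∈ operPart R) : y = z := by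
  rw [mem_operPart] at hy hz
  have h1 := sub_mem_mul hy.1 hz.1
  have h2 := Submodule.sub_mem _ hy.2 hz.2
  exact sub_eq_zero.1 (inner_self_eq_zero (𝕜 := ℂ).1 ((Submodule.mem_orthogonal _ _).1 h2 _ h1))

/-- The value of the operator part has the least norm among all the values. -/
theorem norm_operPart_le {R : Submodule ℂ (E × F)} {x : E} {y z : F}
    (hy : (x, y) ∈ operPart R) (hz : (x, z) ∈ R) : ‖y‖ ≤ ‖z‖ := by
  rw [mem_operPart] at hy
  have h0 : ⟪z - y, y⟫_ℂ = 0 := (Submodule.mem_orthogonal _ _).1 hy.2 _ (sub_mem_mul hz hy.1)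
  have h : ‖z - y + y‖ * ‖z - y + y‖ = ‖z - y‖ * ‖z - y‖ + ‖y‖ * ‖y‖ :=
    norm_add_sq_eq_norm_sq_add_norm_sq_of_inner_eq_zero _ _ h0
  rw [sub_add_cancel] at h
  nlinarith [norm_nonneg y, norm_nonneg z, mul_self_nonneg ‖z - y‖]

/-- Pair with `(0, m)`. Consequently a value of `R` that lies in `dom R*` is automatically the value
of the operator part. -/
theorem snd_mem_orthogonal_mul {R : Submodule ℂ (E × F)} {y : F} {x : E}
    (h : (y, x) ∈ R.adjoint) : y ∈ (mul R)ᗮ := by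
  rw [Submodule.mem_orthogonal]
  intro m hm
  simpa using mem_adjoint.1 h 0 m (mem_mul.1 hm)

/-! ### Selfadjointness and square root of `R* R` -/

/-- For a closed relation `R`, the relation `1 + R* R` maps onto the whole space. -/
theorem exists_resolvent [CompleteSpace E] [CompleteSpace F] {R : Submodule ℂ (E × F)}
    (hR : IsClosed (R : Set (E × F))) :
    ∃ T : E →L[ℂ] E, 0 ≤ T ∧ T ≤ 1 ∧
      comp R.adjoint R = LinearMap.range (T.prod (1 - T) : E →ₗ[ℂ] E × E) := by
  let R' : Submodule ℂ (WithLp 2 (E × F)) :=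
    R.comap (WithLp.linearEquiv 2 ℂ (E × F) : WithLp 2 (E × F) →ₗ[ℂ] E × F)
  have hR' : IsClosed (R' : Set (WithLp 2 (E × F))) :=
    hR.preimage (WithLp.prod_continuous_ofLp 2 E F)
  have : CompleteSpace R' := hR'.completeSpace_coe
  have mem_R' : ∀ p : WithLp 2 (E × F), p ∈ R' ↔ (p.fst, p.snd) ∈ R := fun p => Iff.rfl
  let J : E →L[ℂ] WithLp 2 (E × F) :=
    (WithLp.prodContinuousLinearEquiv 2 ℂ E F).symm.toContinuousLinearMap ∘L
      ContinuousLinearMap.inl ℂ E F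
  let P : WithLp 2 (E × F) →L[ℂ] WithLp 2 (E × F) := R'.starProjection
  -- The compression to `E` of the orthogonal projection onto `R`; it is `(1 + R* R)⁻¹`.
  let T : E →L[ℂ] E := J.adjoint ∘L P ∘L J
  have hJ1 : ∀ u, (J u).fst = u := fun u => rfl
  have hJ2 : ∀ u, (J u).snd = 0 := fun u => rfl
  have hJadj : ∀ p, J.adjoint p = p.fst := by
    intro p
    refine ext_inner_left ℂ fun v => ?_
    rw [ContinuousLinearMap.adjoint_inner_right, WithLp.prod_inner_apply]
    simp [hJ1, hJ2]
  have hT : ∀ u, T u = (P (J u)).fst := fun u => hJadj _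
  have hPpos : P.IsPositive := ContinuousLinearMap.IsPositive.of_isStarProjection
    isStarProjection_starProjection
  have hPpos' : (1 - P).IsPositive := ContinuousLinearMap.IsPositive.of_isStarProjection
    isStarProjection_starProjection.one_sub
  have h1T : 1 - T = J.adjoint ∘L (1 - P) ∘L J := by
    ext u
    simp [T, hJadj, hJ1]
  refine ⟨T, ?_, ?_, ?_⟩
  · rw [ContinuousLinearMap.nonneg_iff_isPositive]
    exact hPpos.adjoint_conj J
  · rw [ContinuousLinearMap.le_def, h1T]
    exact hPpos'.adjoint_conj J
  · ext ⟨f, f'⟩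
    rw [mem_comp]
    constructor
    · rintro ⟨h, h1, h2⟩
      -- The difference `(f + f', 0) - (f, h) = (f', -h)` is orthogonal to `R` precisely because
      -- `(h, f') ∈ R*`.
      have : P (J (f + f')) = WithLp.toLp 2 (f, h) := by
        refine Submodule.eq_starProjection_of_mem_of_inner_eq_zero ?_ ?_
        · exact h1
        · intro p hp
          rw [WithLp.prod_inner_apply]
          have := mem_adjoint.1 h2 _ _ ((mem_R' p).1 hp)
          rw [← inner_conj_symm, ← inner_conj_symm p.fst] at this
          have := (starRingEnd ℂ).injective this
          simp [hJ1, hJ2, this]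
      refine ⟨f + f', ?_⟩
      have h3 : T (f + f') = f := by rw [hT, this]; rfl
      ext
      · exact h3
      · change (f + f') - T (f + f') = f'
        rw [h3, add_sub_cancel_left]
    · rintro ⟨u, hu⟩
      obtain ⟨rfl, rfl⟩ : T u = f ∧ u - T u = f' := by
        simpa [Prod.ext_iff] using hu
      refine ⟨(P (J u)).snd, ?_, ?_⟩
      · rw [hT]
        exact Submodule.starProjection_apply_mem R' (J u)
      · rw [mem_adjoint]
        intro a b hab
        have h : J u - P (J u) ∈ R'ᗮ := Submodule.sub_starProjection_mem_orthogonal (J u)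
        have := (Submodule.mem_orthogonal _ _).1 h (WithLp.toLp 2 (a, b)) hab
        rw [WithLp.prod_inner_apply] at this
        simp only [WithLp.ofLp_fst, WithLp.ofLp_snd, WithLp.sub_fst, WithLp.sub_snd, hJ1, hJ2,
          zero_sub, inner_neg_right] at this
        rw [hT]
        exact (add_neg_eq_zero.1 this).symm

open scoped ComplexOrder in
/-- A pair of commuting nonnegative operators `S`, `C` with `S² + C² = 1` parametrizes a
nonnegative selfadjoint relation. -/
theorem isNonnegSelfAdjoint_range_prod [CompleteSpace E] {S C : E →L[ℂ] E} (hS : 0 ≤ S)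
    (hC : 0 ≤ C) (hcomm : Commute S C) (hSC : S * S + C * C = 1) :
    IsNonnegSelfAdjoint (LinearMap.range (S.prod C : E →ₗ[ℂ] E × E)) := by
  have hcomm' : ∀ u, S (C u) = C (S u) := fun u => congrArg (fun f => f u) hcomm.eq
  have hSC' : ∀ u, S (S u) + C (C u) = u := fun u => congrArg (fun f => f u) hSC
  have hS' := ((ContinuousLinearMap.nonneg_iff_isPositive S).1 hS).isSymmetric
  have hC' := ((ContinuousLinearMap.nonneg_iff_isPositive C).1 hC).isSymmetric
  constructor
  · ext ⟨g, g'⟩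
    rw [mem_adjoint]
    constructor
    · intro h
      have hgg : C g = S g' := by
        refine ext_inner_left ℂ fun u => ?_
        have := h (S u) (C u) ⟨u, rfl⟩
        rw [show ⟪C u, g⟫_ℂ = ⟪u, C g⟫_ℂ from hC' u g,
          show ⟪S u, g'⟫_ℂ = ⟪u, S g'⟫_ℂ from hS' u g'] at this
        exact this
      -- The map `u ↦ (S u, C u)` is isometric with adjoint `(g, g') ↦ S g + C g'`, which recovers
      -- the parameter.
      refine ⟨S g + C g', ?_⟩
      ext
      · change S (S g + C g') = g
        rw [map_add, hcomm', ← hgg, hSC']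
      · change C (S g + C g') = g'
        rw [map_add, ← hcomm', hgg, hSC']
    · rintro ⟨v, hv⟩ a b ⟨u, hu⟩
      obtain ⟨rfl, rfl⟩ : S v = g ∧ C v = g' := by simpa [Prod.ext_iff] using hv
      obtain ⟨rfl, rfl⟩ : S u = a ∧ C u = b := by simpa [Prod.ext_iff] using hu
      rw [show ⟪C u, S v⟫_ℂ = ⟪u, C (S v)⟫_ℂ from hC' u _,
          show ⟪S u, C v⟫_ℂ = ⟪u, S (C v)⟫_ℂ from hS' u _, hcomm']
  · rintro _ ⟨u, rfl⟩
    have hpos := (ContinuousLinearMap.nonneg_iff_isPositive _).1 (hcomm.mul_nonneg hS hC)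
    have h : ⟪C u, S u⟫_ℂ = ⟪(S * C) u, u⟫_ℂ := (hS' (C u) u).symm
    have h0 : 0 ≤ ⟪C u, S u⟫_ℂ := h ▸ hpos.inner_nonneg_left u
    have := Complex.nonneg_iff.1 h0
    exact ⟨this.1, this.2.symm⟩

/-- Matching the middle element gives `S v = C u`, and `S² + C² = 1` then yields the common
parameter `S u + C v`. Taking `S² = T`, `C² = 1 - T` gives the square root of `R* R`. -/
theorem comp_range_prod {S C : E →L[ℂ] E} (hcomm : Commute S C) (hSC : S * S + C * C = 1) :
    comp (LinearMap.range (S.prod C : E →ₗ[ℂ] E × E))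
      (LinearMap.range (S.prod C : E →ₗ[ℂ] E × E)) =
      LinearMap.range ((S * S).prod (C * C) : E →ₗ[ℂ] E × E) := by
  have hcomm' : ∀ u, S (C u) = C (S u) := fun u => congrArg (fun f => f u) hcomm.eq
  have hSC' : ∀ u, S (S u) + C (C u) = u := fun u => congrArg (fun f => f u) hSC
  ext ⟨x, z⟩
  rw [mem_comp]
  constructor
  · rintro ⟨y, ⟨u, hu⟩, ⟨v, hv⟩⟩
    obtain ⟨rfl, rfl⟩ : S u = x ∧ C u = y := by simpa [Prod.ext_iff] using hu
    obtain ⟨h, rfl⟩ : S v = C u ∧ C v = z := by simpa [Prod.ext_iff] using hv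
    refine ⟨S u + C v, ?_⟩
    ext
    · change S (S (S u + C v)) = S u
      rw [map_add S, hcomm' v, h, hSC']
    · change C (C (S u + C v)) = C v
      rw [map_add C, ← hcomm' u, ← h, hSC']
  · rintro ⟨w, hw⟩
    obtain ⟨rfl, rfl⟩ : S (S w) = x ∧ C (C w) = z := by simpa [Prod.ext_iff] using hw
    exact ⟨C (S w), ⟨S w, rfl⟩, ⟨C w, by rw [← hcomm']; rfl⟩⟩

/-- `R* R` has a nonnegative selfadjoint square root, for every closed relation `R`. -/
theorem exists_isSqrt_adjoint_comp_self [CompleteSpace E] [CompleteSpace F]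
    {R : Submodule ℂ (E × F)} (hR : IsClosed (R : Set (E × F))) :
    ∃ K, IsSqrt K (comp R.adjoint R) := by
  obtain ⟨T, h0, h1, h⟩ := exists_resolvent hR
  have h1' : 0 ≤ 1 - T := sub_nonneg.2 h1
  have hS : CFC.sqrt T * CFC.sqrt T = T := CFC.sqrt_mul_sqrt_self T h0
  have hC : CFC.sqrt (1 - T) * CFC.sqrt (1 - T) = 1 - T := CFC.sqrt_mul_sqrt_self _ h1'
  have hT : Commute T (1 - T) := (Commute.one_right T).sub_right (Commute.refl T)
  have hcomm : Commute (CFC.sqrt T) (CFC.sqrt (1 - T)) :=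
    (hT.cfcₙ_nnreal _).symm.cfcₙ_nnreal _ |>.symm
  have hSC : CFC.sqrt T * CFC.sqrt T + CFC.sqrt (1 - T) * CFC.sqrt (1 - T) = 1 := by
    rw [hS, hC, add_sub_cancel]
  refine ⟨_, isNonnegSelfAdjoint_range_prod (CFC.sqrt_nonneg T) (CFC.sqrt_nonneg (1 - T))
    hcomm hSC, ?_⟩
  rw [comp_range_prod hcomm hSC, hS, hC, h]

/-- `R* R` is nonnegative selfadjoint, for every closed relation `R`. -/
theorem isNonnegSelfAdjoint_adjoint_comp_self [CompleteSpace E] [CompleteSpace F]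
    {R : Submodule ℂ (E × F)} (hR : IsClosed (R : Set (E × F))) :
    IsNonnegSelfAdjoint (comp R.adjoint R) := by
  obtain ⟨T, h0, h1, h⟩ := exists_resolvent hR
  have hT := ((ContinuousLinearMap.nonneg_iff_isPositive T).1 h0).isSymmetric
  constructor
  · refine le_antisymm ?_ ?_
    · rintro ⟨g, g'⟩ hg
      rw [mem_adjoint, h] at hg
      rw [h]
      have hgg : g - T g = T g' := by
        refine ext_inner_left ℂ fun u => ?_
        have := hg (T u) (u - T u) ⟨u, rfl⟩
        rw [inner_sub_left, show ⟪T u, g⟫_ℂ = ⟪u, T g⟫_ℂ from hT u g,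
          show ⟪T u, g'⟫_ℂ = ⟪u, T g'⟫_ℂ from hT u g'] at this
        rw [inner_sub_right, this]
      have h3 : T (g + g') = g := by rw [map_add, ← hgg, add_sub_cancel]
      refine ⟨g + g', ?_⟩
      ext
      · exact h3
      · change (g + g') - T (g + g') = g'
        rw [h3, add_sub_cancel_left]
    · rintro ⟨g, g'⟩ ⟨k, hk, hk'⟩
      rw [mem_adjoint]
      rintro f f' ⟨h, hf, hf'⟩
      rw [← mem_adjoint.1 hk' f h hf, ← inner_conj_symm, ← mem_adjoint.1 hf' g k hk,
        inner_conj_symm]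
  · rintro ⟨f, f'⟩ ⟨k, hk, hk'⟩
    have := mem_adjoint.1 hk' f k hk
    have h2 : ⟪f', f⟫_ℂ = ((‖k‖ ^ 2 : ℝ) : ℂ) := by
      rw [← inner_conj_symm, ← this, inner_self_eq_norm_sq_to_K]
      simp
    rw [h2]
    exact ⟨by simpa only [Complex.ofReal_re] using sq_nonneg ‖k‖, Complex.ofReal_im _⟩

/-! ### What `R* R` determines about `R` -/

open Filter Topology

/-- The restriction of `R` to the domain of `R* R` is a core for the operator part of the closed
relation `R`. -/
theorem exists_seq_core [CompleteSpace E] [CompleteSpace F] {R : Submodule ℂ (E × F)}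
    (hR : IsClosed (R : Set (E × F))) {x : E} {y : F} (hxy : (x, y) ∈ operPart R) :
    ∃ (f : ℕ → E) (k : ℕ → F) (f' : ℕ → E), (∀ n, (f n, k n) ∈ R) ∧
      (∀ n, (k n, f' n) ∈ R.adjoint) ∧ Tendsto f atTop (𝓝 x) ∧ Tendsto k atTop (𝓝 y) := by
  let L : WithLp 2 (E × F) →ₗ[ℂ] E × F := (WithLp.linearEquiv 2 ℂ (E × F)).toLinearMap
  let D : Submodule ℂ (WithLp 2 (E × F)) :=
    (R ⊓ (dom R.adjoint).comap (LinearMap.snd ℂ E F)).comap L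
  have mem_D : ∀ p : WithLp 2 (E × F), p ∈ D ↔
      (p.fst, p.snd) ∈ R ∧ ∃ f', (p.snd, f') ∈ R.adjoint := by
    intro p
    simp only [D, Submodule.mem_comap, Submodule.mem_inf, ← mem_dom]
    rfl
  have hDle : D.topologicalClosure ≤ (operPart R).comap L := by
    refine Submodule.topologicalClosure_minimal _ ?_ ?_
    · intro p hp
      obtain ⟨h1, f', h2⟩ := (mem_D p).1 hp
      exact mem_operPart.2 ⟨h1, snd_mem_orthogonal_mul h2⟩
    · exact (isClosed_operPart hR).preimage (WithLp.prod_continuous_ofLp 2 E F)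
  have : CompleteSpace D.topologicalClosure :=
    (Submodule.isClosed_topologicalClosure D).completeSpace_coe
  obtain ⟨d, hd, e, he, hde⟩ := Submodule.exists_add_mem_mem_orthogonal
    (K := D.topologicalClosure) (WithLp.toLp 2 (x, y))
  have heR : (e.fst, e.snd) ∈ operPart R := by
    have h : WithLp.toLp 2 (x, y) - d ∈ (operPart R).comap L :=
      Submodule.sub_mem _ hxy (hDle hd)
    rwa [hde, add_sub_cancel_left] at h
  -- The element `T e.fst` lies in `dom R* R`. Testing `e` against the corresponding pair of `D`
  -- gives `‖e.fst‖² = 0`, as `T = (1 + R* R)⁻¹`.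
  have he1 : e.fst = 0 := by
    obtain ⟨T, -, -, hT⟩ := exists_resolvent hR
    have hmem : (T e.fst, e.fst - T e.fst) ∈ comp R.adjoint R := by
      rw [hT]
      exact ⟨e.fst, rfl⟩
    obtain ⟨k, h1, h2⟩ := mem_comp.1 hmem
    have h3 : WithLp.toLp 2 (T e.fst, k) ∈ D.topologicalClosure :=
      D.le_topologicalClosure ((mem_D _).2 ⟨h1, _, h2⟩)
    have h4 := (Submodule.mem_orthogonal' _ _).1 he _ h3
    rw [WithLp.prod_inner_apply] at h4
    have h5 := mem_adjoint.1 h2 _ _ (mem_operPart.1 heR).1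
    have h6 : ⟪e.fst, T e.fst⟫_ℂ + ⟪e.snd, k⟫_ℂ = 0 := h4
    rw [h5, ← inner_add_right, add_sub_cancel] at h6
    exact inner_self_eq_zero.1 h6
  have he2 : e.snd = 0 := by
    rw [he1] at heR
    exact eq_of_mem_operPart heR (Submodule.zero_mem _)
  have he0 : WithLp.toLp 2 (x, y) = d := by
    rw [hde, (WithLp.ofLp_injective 2 (Prod.ext he1 he2) : e = 0), add_zero]
  rw [← he0] at hd
  obtain ⟨p, hp, hlim⟩ := mem_closure_iff_seq_limit.1 hd
  choose h1 f' h2 using fun n => (mem_D (p n)).1 (hp n)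
  have hlim' := ((WithLp.prod_continuous_ofLp 2 E F).tendsto _).comp hlim
  exact ⟨fun n => (p n).fst, fun n => (p n).snd, f', h1, h2, (continuous_fst.tendsto _).comp hlim',
    (continuous_snd.tendsto _).comp hlim'⟩

/-- Both squared norms equal `⟪f, f'⟫`. -/
theorem norm_eq_of_mem_adjoint {R : Submodule ℂ (E × F)} {K : Submodule ℂ (E × G)} {f f' : E}
    {k : F} {l : G} (h1 : (f, k) ∈ R) (h2 : (k, f') ∈ R.adjoint) (h3 : (f, l) ∈ K)
    (h4 : (l, f') ∈ K.adjoint) : ‖k‖ = ‖l‖ := by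
  have h := (mem_adjoint.1 h2 f k h1).trans (mem_adjoint.1 h4 f l h3).symm
  rw [inner_self_eq_norm_sq_to_K, inner_self_eq_norm_sq_to_K] at h
  have h' : ‖k‖ ^ 2 = ‖l‖ ^ 2 := by exact_mod_cast h
  exact (sq_eq_sq₀ (norm_nonneg _) (norm_nonneg _)).1 h'

/-- The relation `R* R` determines the domain of a closed relation `R` and the norms of the
values of its operator part. -/
theorem exists_operPart_of_adjoint_comp_eq [CompleteSpace E] [CompleteSpace F] [CompleteSpace G]
    {R : Submodule ℂ (E × F)} {K : Submodule ℂ (E × G)} (hR : IsClosed (R : Set (E × F)))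
    (hK : IsClosed (K : Set (E × G))) (h : comp R.adjoint R = comp K.adjoint K) {x : E} {y : F}
    (hxy : (x, y) ∈ operPart R) : ∃ z, (x, z) ∈ operPart K ∧ ‖z‖ = ‖y‖ := by
  obtain ⟨f, k, f', h1, h2, hf, hk⟩ := exists_seq_core hR hxy
  have hmem : ∀ n, (f n, f' n) ∈ comp K.adjoint K := fun n => h ▸ ⟨k n, h1 n, h2 n⟩
  choose l h3 h4 using fun n => mem_comp.1 (hmem n)
  -- Differences of core elements are again core elements, so `k n ↦ l n` preserves distances and
  -- convergence carries over.
  have hdist : ∀ m n, dist (l m) (l n) = dist (k m) (k n) := fun m n => by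
    rw [dist_eq_norm, dist_eq_norm]
    exact (norm_eq_of_mem_adjoint (R.sub_mem (h1 m) (h1 n)) (R.adjoint.sub_mem (h2 m) (h2 n))
      (K.sub_mem (h3 m) (h3 n)) (K.adjoint.sub_mem (h4 m) (h4 n))).symm
  have hl : CauchySeq l := by
    rw [Metric.cauchySeq_iff]
    simp only [hdist]
    exact Metric.cauchySeq_iff.1 hk.cauchySeq
  obtain ⟨z, hz⟩ := cauchySeq_tendsto_of_complete hl
  refine ⟨z, (isClosed_operPart hK).mem_of_tendsto (hf.prodMk_nhds hz) (.of_forall fun n =>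
    mem_operPart.2 ⟨h3 n, snd_mem_orthogonal_mul (h4 n)⟩), ?_⟩
  refine tendsto_nhds_unique hz.norm ?_
  simp only [← norm_eq_of_mem_adjoint (h1 _) (h2 _) (h3 _) (h4 _)]
  exact hk.norm

theorem IsSqrt.isClosed {K R : Submodule ℂ (E × E)} (h : IsSqrt K R) :
    IsClosed (K : Set (E × E)) :=
  h.1.1 ▸ isClosed_adjoint K

theorem IsSqrt.adjoint_comp_self {K R : Submodule ℂ (E × E)} (h : IsSqrt K R) :
    comp K.adjoint K = R := by
  rw [h.1.1, h.2]

/-- The order of `R* R` and `S* S` expressed by the operator parts of `R` and `S`. -/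
theorem opLE_adjoint_comp_self_iff [CompleteSpace E] [CompleteSpace F] [CompleteSpace G]
    {R : Submodule ℂ (E × F)} {S : Submodule ℂ (E × G)} (hR : IsClosed (R : Set (E × F)))
    (hS : IsClosed (S : Set (E × G))) :
    OpLE (comp R.adjoint R) (comp S.adjoint S) ↔ dom S ≤ dom R ∧
      ∀ x y z, (x, y) ∈ operPart R → (x, z) ∈ operPart S → ‖y‖ ≤ ‖z‖ := by
  constructor
  · rintro ⟨-, -, K, L, hK, hL, hKL, hle⟩
    refine ⟨?_, ?_⟩
    · rw [← dom_operPart hS, ← dom_operPart hR]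
      intro x hx
      obtain ⟨z, hz⟩ := mem_dom.1 hx
      obtain ⟨z', hz', -⟩ := exists_operPart_of_adjoint_comp_eq hS hL.isClosed
        hL.adjoint_comp_self.symm hz
      obtain ⟨y', hy'⟩ := mem_dom.1 (hKL (mem_dom.2 ⟨z', hz'⟩))
      obtain ⟨y, hy, -⟩ := exists_operPart_of_adjoint_comp_eq hK.isClosed hR
        hK.adjoint_comp_self hy'
      exact mem_dom.2 ⟨y, hy⟩
    · intro x y z hy hz
      obtain ⟨z', hz', hzn⟩ := exists_operPart_of_adjoint_comp_eq hS hL.isClosed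
        hL.adjoint_comp_self.symm hz
      obtain ⟨y', hy', hyn⟩ := exists_operPart_of_adjoint_comp_eq hR hK.isClosed
        hK.adjoint_comp_self.symm hy
      rw [← hzn, ← hyn]
      exact hle x y' z' hy' hz'
  · rintro ⟨hdom, hle⟩
    obtain ⟨K, hK⟩ := exists_isSqrt_adjoint_comp_self hR
    obtain ⟨L, hL⟩ := exists_isSqrt_adjoint_comp_self hS
    refine ⟨isNonnegSelfAdjoint_adjoint_comp_self hR, isNonnegSelfAdjoint_adjoint_comp_self hS,
      K, L, hK, hL, ?_, ?_⟩
    · intro x hx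
      obtain ⟨z', hz'⟩ := mem_dom.1 hx
      obtain ⟨z, hz, -⟩ := exists_operPart_of_adjoint_comp_eq hL.isClosed hS
        hL.adjoint_comp_self hz'
      have hx' := hdom (mem_dom.2 ⟨z, (mem_operPart.1 hz).1⟩)
      rw [← dom_operPart hR] at hx'
      obtain ⟨y, hy⟩ := mem_dom.1 hx'
      obtain ⟨y', hy', -⟩ := exists_operPart_of_adjoint_comp_eq hR hK.isClosed
        hK.adjoint_comp_self.symm hy
      exact mem_dom.2 ⟨y', hy'⟩
    · intro x y' z' hy' hz'
      obtain ⟨z, hz, hzn⟩ := exists_operPart_of_adjoint_comp_eq hL.isClosed hS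
        hL.adjoint_comp_self hz'
      obtain ⟨y, hy, hyn⟩ := exists_operPart_of_adjoint_comp_eq hK.isClosed hR
        hK.adjoint_comp_self hy'
      rw [← hzn, ← hyn]
      exact hle x y z hy hz

/-! ### Scalar multiples and the degenerate case `c = 0` -/

theorem isClosed_scale {a : ℂ} (ha : a ≠ 0) {R : Submodule ℂ (E × F)}
    (hR : IsClosed (R : Set (E × F))) : IsClosed (scale a R : Set (E × F)) := by
  have : (scale a R : Set (E × F)) = (fun p : E × F => (p.1, a⁻¹ • p.2)) ⁻¹' R := by
    ext ⟨x, z⟩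
    simp only [SetLike.mem_coe, mem_scale, Set.mem_preimage]
    refine ⟨?_, fun h => ⟨_, h, smul_inv_smul₀ ha z⟩⟩
    rintro ⟨y, hy, rfl⟩
    rwa [inv_smul_smul₀ ha]
  rw [this]
  exact hR.preimage (by fun_prop)

theorem adjoint_comp_self_scale {c : ℝ} (hc : c ≠ 0) (R : Submodule ℂ (E × F)) :
    comp (scale (c : ℂ) R).adjoint (scale (c : ℂ) R) = scale ((c : ℂ) ^ 2) (comp R.adjoint R) := by
  have hc' : ((c : ℂ) ^ 2) ≠ 0 := pow_ne_zero 2 (Complex.ofReal_ne_zero.2 hc)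
  have key : ∀ (y : F) (w : E), ((c : ℂ) • y, (c : ℂ) ^ 2 • w) ∈ (scale (c : ℂ) R).adjoint ↔
      (y, w) ∈ R.adjoint := by
    intro y w
    have h : ∀ a b, ⟪(c : ℂ) • b, (c : ℂ) • y⟫_ℂ = ⟪a, (c : ℂ) ^ 2 • w⟫_ℂ ↔ ⟪b, y⟫_ℂ = ⟪a, w⟫_ℂ := by
      intro a b
      rw [inner_smul_left, inner_smul_right, inner_smul_right, Complex.conj_ofReal, ← mul_assoc,
        ← sq, mul_right_inj' hc']
    simp only [mem_adjoint, mem_scale]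
    refine ⟨fun H a b hab => (h a b).1 (H a _ ⟨b, hab, rfl⟩), ?_⟩
    rintro H a _ ⟨b, hab, rfl⟩
    exact (h a b).2 (H a b hab)
  ext ⟨x, z⟩
  simp only [mem_comp, mem_scale]
  constructor
  · rintro ⟨_, ⟨y, hy, rfl⟩, hz⟩
    rw [← smul_inv_smul₀ hc' z, key] at hz
    exact ⟨_, ⟨y, hy, hz⟩, smul_inv_smul₀ hc' z⟩
  · rintro ⟨w, ⟨y, hy, hw⟩, rfl⟩
    exact ⟨_, ⟨y, hy, rfl⟩, (key y w).2 hw⟩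

/-- All values of `0 R` vanish, so its adjoint contains `E × {0}`; selfadjointness puts this back
into `0 R`. -/
theorem dom_eq_top_of_isNonnegSelfAdjoint_scale_zero {R : Submodule ℂ (E × E)}
    (h : IsNonnegSelfAdjoint (scale 0 R)) : dom R = ⊤ := by
  refine eq_top_iff.2 fun x _ => ?_
  have hx : (x, (0 : E)) ∈ (scale 0 R).adjoint := by
    rw [mem_adjoint]
    rintro a b hab
    obtain ⟨y, -, rfl⟩ := mem_scale.1 hab
    simp
  rw [h.1] at hx
  obtain ⟨y, hy, -⟩ := mem_scale.1 hx
  exact mem_dom.2 ⟨y, hy⟩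

/-- If `c² R* R` is nonnegative selfadjoint, then `c R` is closed and `c² R* R = (c R)* (c R)`,
also for `c = 0`. -/
theorem scale_sq_adjoint_comp_self {c : ℝ} {R : Submodule ℂ (E × F)}
    (hR : IsClosed (R : Set (E × F)))
    (h : IsNonnegSelfAdjoint (scale ((c : ℂ) ^ 2) (comp R.adjoint R))) :
    IsClosed (scale (c : ℂ) R : Set (E × F)) ∧
      scale ((c : ℂ) ^ 2) (comp R.adjoint R) =
        comp (scale (c : ℂ) R).adjoint (scale (c : ℂ) R) := by
  rcases eq_or_ne c 0 with rfl | hc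
  · simp only [Complex.ofReal_zero, ne_eq, OfNat.ofNat_ne_zero, not_false_eq_true,
      zero_pow] at h ⊢
    have htop := dom_eq_top_of_isNonnegSelfAdjoint_scale_zero h
    have hmem : ∀ x, ∃ z, (x, z) ∈ comp R.adjoint R := fun x =>
      mem_dom.1 (htop ▸ Submodule.mem_top)
    have h0 : ∀ x z, (x, z) ∈ scale 0 R ↔ z = 0 := by
      intro x z
      rw [mem_scale]
      obtain ⟨_, y, hy, -⟩ := hmem x
      refine ⟨?_, fun hz => ⟨y, hy, by simp [hz]⟩⟩
      rintro ⟨y, -, rfl⟩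
      simp
    constructor
    · have : (scale 0 R : Set (E × F)) = Prod.snd ⁻¹' {0} := by
        ext ⟨x, z⟩
        simp [h0]
      rw [this]
      exact isClosed_singleton.preimage continuous_snd
    · ext ⟨x, z⟩
      rw [mem_scale, mem_comp]
      constructor
      · rintro ⟨y, -, rfl⟩
        exact ⟨0, (h0 _ _).2 rfl, by simp⟩
      · rintro ⟨y, -, hz⟩
        obtain ⟨w, hw⟩ := hmem x
        refine ⟨w, hw, ?_⟩
        have := mem_adjoint.1 hz z 0 ((h0 _ _).2 rfl)
        rw [inner_zero_left] at this
        rw [zero_smul, inner_self_eq_zero.1 this.symm]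
  · exact ⟨isClosed_scale (Complex.ofReal_ne_zero.2 hc) hR, (adjoint_comp_self_scale hc R).symm⟩

theorem smul_mem_operPart_scale {a : ℂ} {R : Submodule ℂ (E × F)} {x : E} {y : F}
    (h : (x, y) ∈ operPart R) : (x, a • y) ∈ operPart (scale a R) := by
  rw [mem_operPart] at h ⊢
  refine ⟨mem_scale.2 ⟨y, h.1, rfl⟩, (Submodule.mem_orthogonal _ _).2 fun m hm => ?_⟩
  obtain ⟨n, hn, rfl⟩ := mem_scale.1 (mem_mul.1 hm)
  rw [inner_smul_left, inner_smul_right, (Submodule.mem_orthogonal _ _).1 h.2 n (mem_mul.2 hn)]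
  simp

/-! ### Bounded extension and Hilbert space dimension -/

/-- A relation `R` whose values are bounded by a multiple of the arguments is contained in the
graph of a bounded everywhere defined operator that vanishes on the complement of `dom R`. -/
theorem exists_continuousLinearMap_of_norm_le [CompleteSpace E] [CompleteSpace F]
    {R : Submodule ℂ (E × F)} {c : ℝ} (h : ∀ p ∈ R, ‖p.2‖ ≤ c * ‖p.1‖) :
    ∃ W : E →L[ℂ] F, (∀ p ∈ R, W p.1 = p.2) ∧ ∀ m ∈ (dom R)ᗮ, W m = 0 := by
  have : CompleteSpace (dom R).topologicalClosure :=
    (Submodule.isClosed_topologicalClosure _).completeSpace_coe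
  -- Both coordinates are functions on `R`; the bound makes the second one factor through the first.
  let e : R →ₗ[ℂ] (dom R).topologicalClosure :=
    ((LinearMap.fst ℂ E F).comp R.subtype).codRestrict _ fun p =>
      (dom R).le_topologicalClosure (mem_dom.2 ⟨_, p.2⟩)
  let f : R →ₗ[ℂ] F := (LinearMap.snd ℂ E F).comp R.subtype
  have he : DenseRange e := by
    intro m
    rw [closure_subtype]
    have : Subtype.val '' Set.range e = (dom R : Set E) := by
      ext x
      rw [SetLike.mem_coe, mem_dom]
      constructor
      · rintro ⟨_, ⟨p, rfl⟩, rfl⟩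
        exact ⟨_, p.2⟩
      · rintro ⟨y, hy⟩
        exact ⟨_, ⟨⟨_, hy⟩, rfl⟩, rfl⟩
    rw [this]
    exact m.2
  have hf : ∀ p, ‖f p‖ ≤ c * ‖e p‖ := fun p => h p p.2
  refine ⟨(f.extendOfNorm e) ∘L (dom R).topologicalClosure.orthogonalProjectionOnto, ?_, ?_⟩
  · intro p hp
    have h1 : (dom R).topologicalClosure.orthogonalProjectionOnto p.1 = e ⟨p, hp⟩ :=
      Submodule.orthogonalProjectionOnto_mem_subspace_eq_self (e ⟨p, hp⟩)
    rw [ContinuousLinearMap.comp_apply, h1, LinearMap.extendOfNorm_eq he ⟨c, hf⟩]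
    rfl
  · intro m hm
    rw [ContinuousLinearMap.comp_apply,
      Submodule.orthogonalProjectionOnto_eq_zero_iff.2, map_zero]
    rwa [Submodule.orthogonal_closure]

theorem exists_orthonormal_mk_eq_hilbertDim (E : Type u) [NormedAddCommGroup E]
    [InnerProductSpace ℂ E] [CompleteSpace E] :
    ∃ s : Set E, Orthonormal ℂ ((↑) : s → E) ∧ (Submodule.span ℂ s).topologicalClosure = ⊤ ∧
      Cardinal.mk s = hilbertDim E := by
  refine csInf_mem (s := {κ | ∃ s : Set E, Orthonormal ℂ ((↑) : s → E) ∧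
    (Submodule.span ℂ s).topologicalClosure = ⊤ ∧ Cardinal.mk s = κ}) ?_
  obtain ⟨s, b, hb⟩ := exists_hilbertBasis ℂ E
  refine ⟨_, s, hb ▸ b.orthonormal, ?_, rfl⟩
  simpa [hb] using b.dense_span

/-- If a bounded operator maps `E` onto `F`, then an orthonormal set in `F` has at most the
cardinality of a total set in `E`. -/
theorem lift_mk_le_of_surjective [CompleteSpace E] (Q : E →L[ℂ] F)
    (hQ : Function.Surjective Q) {s : Set E}
    (hspan : (Submodule.span ℂ s).topologicalClosure = ⊤) {t : Set F}
    (ht : Orthonormal ℂ ((↑) : t → F)) :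
    Cardinal.lift.{u} (Cardinal.mk t) ≤ Cardinal.lift.{v} (Cardinal.mk s) := by
  rcases s.finite_or_infinite with hfin | hinf
  · have : FiniteDimensional ℂ (Submodule.span ℂ s) := FiniteDimensional.span_of_finite ℂ hfin
    rw [(Submodule.closed_of_finiteDimensional (Submodule.span ℂ s)).submodule_topologicalClosure_eq]
      at hspan
    calc Cardinal.lift.{u} (Cardinal.mk t) ≤ Cardinal.lift.{u} (Module.rank ℂ F) :=
          Cardinal.lift_le.2 ht.linearIndependent.cardinal_le_rank
      _ ≤ Cardinal.lift.{v} (Module.rank ℂ E) :=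
          LinearMap.lift_rank_le_of_surjective (Q : E →ₗ[ℂ] F) hQ
      _ ≤ Cardinal.lift.{v} (Cardinal.mk s) := by
          rw [Cardinal.lift_le, ← rank_top ℂ E, ← hspan]
          exact rank_span_le s
  -- Each `n ∈ t` pairs nontrivially with some `Q i`, since otherwise `n ⟂ ran Q`. By Bessel each `Q
  -- i` meets only countably many `n`, so `t` has at most `ℵ₀ · #s = #s` elements.
  · have hcover : ∀ n : t, ∃ i : s, ⟪(n : F), Q i⟫_ℂ ≠ 0 := by
      intro n
      by_contra! h
      have hle : (Submodule.span ℂ s).topologicalClosure ≤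
          LinearMap.ker ((innerSL ℂ (n : F)) ∘L Q : E →L[ℂ] ℂ).toLinearMap := by
        refine Submodule.topologicalClosure_minimal _ (Submodule.span_le.2 fun i hi => ?_)
          (ContinuousLinearMap.isClosed_ker _)
        exact h ⟨i, hi⟩
      obtain ⟨e, he⟩ := hQ n
      have h0 : ⟪(n : F), Q e⟫_ℂ = 0 := hle (hspan ▸ Submodule.mem_top : e ∈ _)
      rw [he, inner_self_eq_zero] at h0
      exact ht.ne_zero n h0
    have hcount : ∀ i : s, {n : t | ⟪(n : F), Q i⟫_ℂ ≠ 0}.Countable := by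
      intro i
      have h := (ht.inner_products_summable (Q i)).countable_support
      refine h.mono fun n hn => ?_
      simpa using hn
    have huniv : (⋃ i : s, {n : t | ⟪(n : F), Q i⟫_ℂ ≠ 0}) = Set.univ :=
      Set.eq_univ_of_forall fun n => Set.mem_iUnion.2 (hcover n)
    have hinf' : Cardinal.aleph0 ≤ Cardinal.mk s := Cardinal.aleph0_le_mk_iff.2 hinf.to_subtype
    have h := Cardinal.mk_iUnion_le_sum_mk_lift
      (f := fun i : s => {n : t | ⟪(n : F), Q i⟫_ℂ ≠ 0})
    rw [huniv, Cardinal.mk_univ] at h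
    calc Cardinal.lift.{u} (Cardinal.mk t) ≤ _ := h
      _ ≤ Cardinal.sum fun _ : s => Cardinal.aleph0.{v} :=
          Cardinal.sum_le_sum _ _ fun i => (hcount i).le_aleph0
      _ = Cardinal.lift.{v} (Cardinal.mk s) := by
          rw [Cardinal.sum_const, Cardinal.lift_aleph0]
          exact Cardinal.mul_aleph0_eq (Cardinal.aleph0_le_lift.2 hinf')

/-- Injecting an orthonormal basis of `F` into one of `E` gives an isometry `V : F → E`, and `V* V =
1` makes `V*` surjective. -/
theorem exists_surjective_of_hilbertDim_le [CompleteSpace E] [CompleteSpace F]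
    (h : Cardinal.lift.{u} (hilbertDim F) ≤ Cardinal.lift.{v} (hilbertDim E)) :
    ∃ Q : E →L[ℂ] F, Function.Surjective Q := by
  obtain ⟨s, hs, -, hsc⟩ := exists_orthonormal_mk_eq_hilbertDim E
  obtain ⟨t, ht, htspan, htc⟩ := exists_orthonormal_mk_eq_hilbertDim F
  rw [← hsc, ← htc, Cardinal.lift_mk_le'] at h
  obtain ⟨ι⟩ := h
  let b : HilbertBasis t ℂ F := HilbertBasis.mk ht (by simp [htspan])
  have ho : Orthonormal ℂ fun i : t => (ι i : E) := hs.comp ι ι.injective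
  let V : F →ₗᵢ[ℂ] E := ho.orthogonalFamily.linearIsometry.comp b.repr.toLinearIsometry
  refine ⟨V.toContinuousLinearMap.adjoint, fun y => ⟨V y, ?_⟩⟩
  refine ext_inner_left ℂ fun z => ?_
  rw [ContinuousLinearMap.adjoint_inner_right]
  exact V.inner_map_map z y

/-- The Hilbert space dimension of `F` is at most that of `E` if and only if `F` is the image of
`E` under a bounded operator. -/
theorem hilbertDim_le_iff_exists_surjective [CompleteSpace E] [CompleteSpace F] :
    Cardinal.lift.{u} (hilbertDim F) ≤ Cardinal.lift.{v} (hilbertDim E) ↔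
      ∃ Q : E →L[ℂ] F, Function.Surjective Q := by
  refine ⟨exists_surjective_of_hilbertDim_le, fun ⟨Q, hQ⟩ => ?_⟩
  obtain ⟨s, -, hspan, hsc⟩ := exists_orthonormal_mk_eq_hilbertDim E
  obtain ⟨t, ht, -, htc⟩ := exists_orthonormal_mk_eq_hilbertDim F
  rw [← hsc, ← htc]
  exact lift_mk_le_of_surjective Q hQ hspan ht

/-! ### The factorization `A = Z B` -/

variable {A : Submodule ℂ (E × F)} {B : Submodule ℂ (E × G)}

theorem mem_comp_graph {Z : G →L[ℂ] F} {x : E} {y : F} :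
    (x, y) ∈ comp (Z : G →ₗ[ℂ] F).graph B ↔ ∃ z, (x, z) ∈ B ∧ Z z = y := by
  simp [mem_comp, LinearMap.mem_graph_iff, eq_comm]

theorem exists_surjective_mul_of_eq_comp {Z : G →L[ℂ] F}
    (hZ : A = comp (Z : G →ₗ[ℂ] F).graph B) :
    ∃ Q : mul B →L[ℂ] mul A, Function.Surjective Q := by
  have hmem : ∀ m : mul B, Z m ∈ mul A := fun m => by
    rw [mem_mul, hZ, mem_comp_graph]
    exact ⟨m, mem_mul.1 m.2, rfl⟩
  refine ⟨(Z ∘L (mul B).subtypeL).codRestrict (mul A) hmem, fun ⟨y, hy⟩ => ?_⟩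
  rw [mem_mul, hZ, mem_comp_graph] at hy
  obtain ⟨z, hz, rfl⟩ := hy
  exact ⟨⟨z, mem_mul.2 hz⟩, rfl⟩

/-- Sufficiency of the factorization conditions in terms of the operator parts. -/
theorem exists_eq_comp_graph [CompleteSpace F] [CompleteSpace G]
    (hA : IsClosed (A : Set (E × F))) (hB : IsClosed (B : Set (E × G))) (hdom : dom A = dom B)
    {c : ℝ} (hle : ∀ x y z, (x, y) ∈ operPart A → (x, z) ∈ operPart B → ‖y‖ ≤ c * ‖z‖)
    {Q : mul B →L[ℂ] mul A} (hQ : Function.Surjective Q) :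
    ∃ Z : G →L[ℂ] F, A = comp (Z : G →ₗ[ℂ] F).graph B := by
  have : CompleteSpace (mul B) := (isClosed_mul hB).completeSpace_coe
  -- The relation `Aₛ Bₛ⁻¹`, i.e. `Bₛ x ↦ Aₛ x`.
  let R : Submodule ℂ (G × F) :=
    comp (operPart A) ((operPart B).comap (LinearEquiv.prodComm ℂ G E : G × E →ₗ[ℂ] E × G))
  have mem_R : ∀ z y, (z, y) ∈ R ↔ ∃ x, (x, z) ∈ operPart B ∧ (x, y) ∈ operPart A :=
    fun z y => Iff.rfl
  obtain ⟨W, hW, hW0⟩ := exists_continuousLinearMap_of_norm_le (R := R) (c := c) (by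
    rintro ⟨z, y⟩ hp
    obtain ⟨x, hz, hy⟩ := (mem_R z y).1 hp
    exact hle x y z hy hz)
  let P : G →L[ℂ] mul B := (mul B).orthogonalProjectionOnto
  -- `W` acts on `ran Bₛ` and kills `mul B`; the second summand does the opposite.
  let Z : G →L[ℂ] F := W + (mul A).subtypeL ∘L Q ∘L P
  have hZ : ∀ x y z (m : mul B), (x, y) ∈ operPart A → (x, z) ∈ operPart B →
      Z (z + m) = y + Q m := by
    intro x y z m hy hz
    have h1 : W z = y := hW (z, y) ((mem_R z y).2 ⟨x, hz, hy⟩)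
    have h2 : W m = 0 := by
      refine hW0 m ((Submodule.mem_orthogonal' _ _).2 fun z' hz' => ?_)
      obtain ⟨y', hy'⟩ := mem_dom.1 hz'
      obtain ⟨x', hx', -⟩ := (mem_R z' y').1 hy'
      exact (Submodule.mem_orthogonal _ _).1 (mem_operPart.1 hx').2 m m.2
    have h3 : P z = 0 :=
      Submodule.orthogonalProjectionOnto_eq_zero_iff.2 (mem_operPart.1 hz).2
    have h4 : P m = m := Submodule.orthogonalProjectionOnto_mem_subspace_eq_self m
    simp [Z, h1, h2, h3, h4]
  refine ⟨Z, le_antisymm ?_ ?_⟩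
  · rintro ⟨x, a⟩ ha
    rw [mem_comp_graph]
    obtain ⟨y, hy, hay⟩ := exists_operPart hA ha
    obtain ⟨b, hb⟩ := mem_dom.1 (hdom ▸ mem_dom.2 ⟨a, ha⟩)
    obtain ⟨z, hz, -⟩ := exists_operPart hB hb
    obtain ⟨m, hm⟩ := hQ ⟨_, hay⟩
    refine ⟨z + m, ?_, ?_⟩
    · simpa using B.add_mem (mem_operPart.1 hz).1 (mem_mul.1 m.2)
    · rw [hZ x y z m hy hz, hm]
      simp
  · rintro ⟨x, a⟩ ha
    rw [mem_comp_graph] at ha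
    obtain ⟨b, hb, rfl⟩ := ha
    obtain ⟨z, hz, hm⟩ := exists_operPart hB hb
    obtain ⟨a', ha'⟩ := mem_dom.1 (hdom.symm ▸ mem_dom.2 ⟨b, hb⟩)
    obtain ⟨y, hy, -⟩ := exists_operPart hA ha'
    have h := hZ x y z ⟨_, hm⟩ hy hz
    rw [add_sub_cancel] at h
    rw [h]
    simpa using A.add_mem (mem_operPart.1 hy).1 (mem_mul.1 (Q ⟨_, hm⟩).2)

theorem dom_eq_of_eq_comp_graph {Z : G →L[ℂ] F} (hZ : A = comp (Z : G →ₗ[ℂ] F).graph B) :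
    dom A = dom B := by
  ext x
  simp only [mem_dom]
  constructor
  · rintro ⟨y, hy⟩
    rw [hZ, mem_comp_graph] at hy
    obtain ⟨z, hz, -⟩ := hy
    exact ⟨z, hz⟩
  · rintro ⟨z, hz⟩
    exact ⟨Z z, hZ ▸ mem_comp_graph.2 ⟨z, hz, rfl⟩⟩

theorem opLE_of_eq_comp_graph [CompleteSpace E] [CompleteSpace F] [CompleteSpace G]
    (hA : IsClosed (A : Set (E × F))) (hB : IsClosed (B : Set (E × G))) {Z : G →L[ℂ] F}
    (hZ : A = comp (Z : G →ₗ[ℂ] F).graph B) {c : ℝ} (hc : 0 < c) (hcZ : ‖Z‖ ≤ c) :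
    OpLE (comp A.adjoint A) (scale ((c : ℂ) ^ 2) (comp B.adjoint B)) := by
  rw [← adjoint_comp_self_scale hc.ne',
    opLE_adjoint_comp_self_iff hA (isClosed_scale (Complex.ofReal_ne_zero.2 hc.ne') hB)]
  refine ⟨?_, ?_⟩
  · rw [dom_eq_of_eq_comp_graph hZ]
    intro x hx
    obtain ⟨_, hz⟩ := mem_dom.1 hx
    obtain ⟨z, hz, -⟩ := mem_scale.1 hz
    exact mem_dom.2 ⟨z, hz⟩
  · intro x y w hy hw
    obtain ⟨z, hz, rfl⟩ := mem_scale.1 (mem_operPart.1 hw).1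
    have hxz : (x, Z z) ∈ A := by
      rw [hZ]
      exact mem_comp_graph.2 ⟨z, hz, rfl⟩
    calc ‖y‖ ≤ ‖Z z‖ := norm_operPart_le hy hxz
      _ ≤ c * ‖z‖ := Z.le_of_opNorm_le hcZ z
      _ = ‖(c : ℂ) • z‖ := by rw [norm_smul, Complex.norm_real, Real.norm_of_nonneg hc.le]

theorem norm_operPart_le_of_opLE [CompleteSpace E] [CompleteSpace F] [CompleteSpace G]
    (hA : IsClosed (A : Set (E × F))) (hB : IsClosed (B : Set (E × G))) {c : ℝ} (hc : 0 ≤ c)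
    (h : OpLE (comp A.adjoint A) (scale ((c : ℂ) ^ 2) (comp B.adjoint B))) {x : E} {y : F} {z : G}
    (hy : (x, y) ∈ operPart A) (hz : (x, z) ∈ operPart B) : ‖y‖ ≤ c * ‖z‖ := by
  obtain ⟨hcl, heq⟩ := scale_sq_adjoint_comp_self hB h.2.1
  rw [heq, opLE_adjoint_comp_self_iff hA hcl] at h
  calc ‖y‖ ≤ ‖(c : ℂ) • z‖ := h.2 x y _ hy (smul_mem_operPart_scale hz)
    _ = c * ‖z‖ := by rw [norm_smul, Complex.norm_real, Real.norm_of_nonneg hc]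

end Hilbert

end LinRel

theorem proposition4p5 {H : Type u} {HA : Type v} {HB : Type w}
    [NormedAddCommGroup H] [InnerProductSpace ℂ H] [CompleteSpace H]
    [NormedAddCommGroup HA] [InnerProductSpace ℂ HA] [CompleteSpace HA]
    [NormedAddCommGroup HB] [InnerProductSpace ℂ HB] [CompleteSpace HB]
    (A : Submodule ℂ (H × HA)) (B : Submodule ℂ (H × HB))
    (hA : IsClosed (A : Set (H × HA))) (hB : IsClosed (B : Set (H × HB))) :
    (∃ Z : HB →L[ℂ] HA, A = LinRel.comp (Z : HB →ₗ[ℂ] HA).graph B) ↔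
      ((∃ c : ℝ, 0 ≤ c ∧
          LinRel.OpLE (LinRel.comp A.adjoint A)
            (LinRel.scale ((c : ℂ) ^ 2) (LinRel.comp B.adjoint B))) ∧
        LinRel.dom A = LinRel.dom B ∧
        Cardinal.lift.{w} (LinRel.hilbertDim (LinRel.mul A)) ≤
          Cardinal.lift.{v} (LinRel.hilbertDim (LinRel.mul B))) := by
  have : CompleteSpace (LinRel.mul A) := (LinRel.isClosed_mul hA).completeSpace_coe
  have : CompleteSpace (LinRel.mul B) := (LinRel.isClosed_mul hB).completeSpace_coe
  rw [LinRel.hilbertDim_le_iff_exists_surjective]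
  constructor
  · rintro ⟨Z, hZ⟩
    -- The `+ 1` keeps `c` positive: for `c = 0` the relation `c² B* B` need not be selfadjoint.
    have hc : 0 < ‖Z‖ + 1 := by positivity
    exact ⟨⟨‖Z‖ + 1, hc.le, LinRel.opLE_of_eq_comp_graph hA hB hZ hc (by linarith)⟩,
      LinRel.dom_eq_of_eq_comp_graph hZ, LinRel.exists_surjective_mul_of_eq_comp hZ⟩
  · rintro ⟨⟨c, hc, hle⟩, hdom, Q, hQ⟩
    exact LinRel.exists_eq_comp_graph hA hB hdom
      (fun x y z hy hz => LinRel.norm_operPart_le_of_opLE hA hB hc hle hy hz) hQ
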